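/- Let $n \ge 14$ and let $G$ be a loopless multigraph on $n$ vertices whose edges are coloured with two colours, such that no two parallel edges have the same colour and every vertex is incident with edges of both colours (that is, $G$ has rainbow degree 2). If $G$ has at least $\binom{n}{2}+\binom{n-3}{2}+4$ edges, then $G$ has a proper Hamiltonian path, i.e. a path that contains all the vertices of $G$ and in which any two consecutive edges have different colours. Moreover, for odd $n$ the bound on the number of edges is tight: for every odd $n \ge 14$ there is such a multigraph on $n$ vertices, of rainbow degree 2, with exactly $\binom{n}{2}+\binom{n-3}{2}+3$ edges and without a proper Hamiltonian path. -/

import Mathlib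

/-- A multigraph on the vertex set `V` whose edges are coloured with colours from `C`, without loops
and without two parallel edges of the same colour.  It is given by its colour classes:
`G.colourClass i` is the simple graph on `V` formed by the edges of colour `i`, so that two vertices
are joined by at most one edge of each colour, but possibly by several edges of distinct colours. -/
structure EdgeColouredMultigraph (V : Type*) (C : Type*) where
  /-- The spanning subgraph formed by the edges of a given colour. -/
  colourClass : C → SimpleGraph V

namespace EdgeColouredMultigraph

variable {V : Type*} {C : Type*}

/-- The number of edges: parallel edges (of distinct colours) are all counted. -/
noncomputable def numEdges [Fintype C] (G : EdgeColouredMultigraph V C) : ℕ :=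
  ∑ i : C, (G.colourClass i).edgeSet.ncard

/-- The rainbow degree of a vertex `x`: the number of different colours on the edges incident
to `x`. -/
noncomputable def vertexRainbowDegree (G : EdgeColouredMultigraph V C) (x : V) : ℕ :=
  {i : C | ∃ y : V, (G.colourClass i).Adj x y}.ncard

/-- The rainbow degree of a multigraph: the minimum rainbow degree among its vertices. -/
noncomputable def rainbowDegree (G : EdgeColouredMultigraph V C) : ℕ :=
  ⨅ x : V, G.vertexRainbowDegree x

/-- The vertices `v 0, v 1, …, v k`, together with edges joining `v i` and `v (i + 1)` of colour
`c i`, form a properly coloured path: the vertices are distinct, the edges are present,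
and consecutive edges have different colours. -/
structure IsProperPath (G : EdgeColouredMultigraph V C) {k : ℕ}
    (v : Fin (k + 1) → V) (c : Fin k → C) : Prop where
  injective : Function.Injective v
  adj : ∀ i : Fin k, (G.colourClass (c i)).Adj (v i.castSucc) (v i.succ)
  proper : ∀ i j : Fin k, (i : ℕ) + 1 = (j : ℕ) → c i ≠ c j

/-- There is a properly coloured path that contains all the vertices. -/
def HasProperHamiltonianPath (G : EdgeColouredMultigraph V C) : Prop :=
  ∃ (k : ℕ) (v : Fin (k + 1) → V) (c : Fin k → C),
    G.IsProperPath v c ∧ ∀ x : V, ∃ i, v i = x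

end EdgeColouredMultigraph

/-!
Let colour `c` be the one that misses more edges. Add one new vertex if `n` is odd and two if `n` is
even, joined to everything in both colours. Counting the edges missing between components, Tutte's
theorem gives a perfect matching `m` in colour `c`. The other colour misses so few edges that `m`
extends to a Hamiltonian cycle alternating between `m` and that colour: contract `m y`, `y`, `z`,
`m z` to one matching edge for an edge `y z` of the other colour such that many missing edges meet
`y` or `z`, and induct. Cutting the cycle at a new vertex leaves a proper Hamiltonian path of the
original multigraph. If `m` does not join the two new vertices, then either colour `c` has a perfect
matching without them and `m` can be replaced, or the new vertices are contracted first and the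
cycle is cut at the resulting edge.

For the sharpness, in a proper path with an odd number of vertices each colour is a matching that
covers all vertices but one, so no three vertices can have the same unique neighbour in a colour.
-/

open Finset

section MatchingCycle

variable {W : Type*}

theorem isChain_imp_of_mem_dropLast {R S : W → W → Prop} {l : List W}
    (h : ∀ u ∈ l.dropLast, ∀ v ∈ l.tail, R u v → S u v) (hl : l.IsChain R) : l.IsChain S := by
  rw [List.isChain_iff_forall₂, List.forall₂_iff_zip] at hl ⊢
  exact ⟨hl.1, fun {u v} huv => h u (List.of_mem_zip huv).1 v (List.of_mem_zip huv).2 (hl.2 huv)⟩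

/-- A matching is encoded by the involution `m` exchanging the ends of its edges, so that unmatched
vertices are fixed. A matching cycle enters every matching edge exactly once, at one of its ends,
which are the entries of `s`, and leaves it at the other end; the step from there to the next entry
avoids `H`. Read together with the matching edges it is a cycle that alternates between `m` and the
complement of `H`. -/
structure IsMatchingCycle (m : W → W) (H : SimpleGraph W) (s : Cycle W) : Prop where
  nodup : s.Nodup
  mem_iff : ∀ w, w ∈ s ↔ m w ≠ w ∧ m w ∉ s
  chain : s.Chain fun u v => ¬ H.Adj (m u) v

variable {m : W → W} {H : SimpleGraph W} {s : Cycle W}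

namespace IsMatchingCycle

theorem reverse_map (hm : m.Involutive) (h : IsMatchingCycle m H s) :
    IsMatchingCycle m H (s.reverse.map m) := by
  have hmem (w : W) : w ∈ s.reverse.map m ↔ m w ∈ s := by
    simp only [Cycle.mem_map, Cycle.mem_reverse_iff]
    exact ⟨by rintro ⟨u, hu, rfl⟩; rwa [hm], fun hw => ⟨m w, hw, hm w⟩⟩
  refine ⟨?_, fun w => ?_, ?_⟩
  · induction s using Quotient.inductionOn' with | h l => ?_
    exact (List.nodup_reverse.2 h.nodup).map hm.injective
  · rw [hmem, hmem, h.mem_iff, hm, ne_comm]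
  · rw [Cycle.chain_map]
    have hch := h.chain
    induction s using Cycle.induction_on with
    | nil => trivial
    | cons a l _ =>
    rw [Cycle.reverse_coe, List.reverse_cons, ← Cycle.coe_cons_eq_coe_append,
      Cycle.chain_coe_cons] at *
    rw [← List.isChain_reverse]
    simpa [hm _, H.adj_comm, flip] using hch

theorem exists_cons (hm : m.Involutive) (h : IsMatchingCycle m H s) {b : W} (hb : m b ≠ b) :
    ∃ l : List W, IsMatchingCycle m H (b :: l) := by
  wlog hbs : b ∈ s generalizing s
  · refine this (h.reverse_map hm) (Cycle.mem_map.2 ⟨m b, ?_, hm b⟩)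
    rw [Cycle.mem_reverse_iff]
    by_contra hmb
    exact hbs ((h.mem_iff b).2 ⟨hb, hmb⟩)
  induction s using Quotient.inductionOn' with | h l₀ => ?_
  obtain ⟨l₁, l₂, rfl⟩ := List.append_of_mem (Cycle.mem_coe_iff.1 hbs)
  have hrot : ((l₁ ++ b :: l₂ : List W) : Cycle W) = (b :: (l₂ ++ l₁) : List W) :=
    Cycle.coe_eq_coe.2 (List.isRotated_append (l := l₁) (l' := b :: l₂))
  exact ⟨l₂ ++ l₁, hrot ▸ h⟩

end IsMatchingCycle

section Contraction

/-- A nonadjacent pair `y`, `z` of vertices from two different edges of the matching `m`: the step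
from `m y` through `y` to `z` is then allowed in a matching cycle, so that the path
`m y`, `y`, `z`, `m z` can be contracted to a single matching edge. -/
structure IsContractible (m : W → W) (H : SimpleGraph W) (y z : W) : Prop where
  left_ne : m y ≠ y
  right_ne : m z ≠ z
  ne : z ≠ y
  ne_apply : z ≠ m y
  not_adj : ¬ H.Adj y z

/-- The matching `m` with the edges at `y` and at `z` replaced by a single one joining `m y` to
`m z`; the vertices `y` and `z` become unmatched, that is, fixed. -/
def contractMatching [DecidableEq W] (m : W → W) (y z w : W) : W :=
  if w = y ∨ w = z then w else if w = m y then m z else if w = m z then m y else m w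

variable {y z : W} [DecidableEq W]

namespace IsContractible

theorem involutive_contractMatching (hm : m.Involutive) (h : IsContractible m H y z) :
    (contractMatching m y z).Involutive := by
  intro w
  grind [contractMatching, IsContractible, hm w, hm y, hm z]

theorem contractMatching_ne_iff (hm : m.Involutive) (h : IsContractible m H y z) {w : W} :
    contractMatching m y z w ≠ w ↔ m w ≠ w ∧ w ≠ y ∧ w ≠ z := by
  grind [contractMatching, IsContractible, hm w, hm y, hm z]

theorem contractMatching_apply_right (hm : m.Involutive) (h : IsContractible m H y z) :
    contractMatching m y z (m z) = m y := by
  grind [contractMatching, IsContractible, hm y, hm z]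

end IsContractible

theorem IsMatchingCycle.exists_of_contractMatching (hm : m.Involutive)
    (h : IsContractible m H y z)
    (hs : IsMatchingCycle (contractMatching m y z)
      ((H.deleteIncidenceSet y).deleteIncidenceSet z) s) :
    ∃ s', IsMatchingCycle m H s' := by
  have hmy : contractMatching m y z (m y) ≠ m y :=
    (h.contractMatching_ne_iff hm).2 ⟨(hm y).symm ▸ h.left_ne.symm, h.left_ne, h.ne_apply.symm⟩
  obtain ⟨l, hnodup, hmem, hch⟩ := hs.exists_cons (h.involutive_contractMatching hm) hmy
  obtain ⟨hy, hz, hne, hne', hadj⟩ := h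
  have hmm := hm y; have hmmz := hm z
  simp only [Cycle.mem_coe_iff, List.mem_cons] at hmem
  simp only [Cycle.nodup_coe_iff, List.nodup_cons] at hnodup
  have hl : ∀ u ∈ l, u ≠ y ∧ u ≠ z ∧ u ≠ m y ∧ u ≠ m z := fun u hu => by
    have := hmem u
    grind [contractMatching]
  refine ⟨(m y :: z :: l : List W), ?_, fun w => ?_, ?_⟩
  · simp only [Cycle.nodup_coe_iff, List.nodup_cons, List.mem_cons, not_or]
    grind
  · have := hmem w; have := hm w
    simp only [Cycle.mem_coe_iff, List.mem_cons]
    grind [contractMatching]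
  · rw [Cycle.chain_coe_cons, List.isChain_cons] at hch
    rw [Cycle.chain_coe_cons, List.cons_append, List.isChain_cons_cons, List.isChain_cons, hm y]
    refine ⟨hadj, fun v hv hzv => hch.1 v hv ?_,
      isChain_imp_of_mem_dropLast (fun u hu v hv huv huv' => huv ?_) hch.2⟩
    · have : v ∈ l ++ [m y] := List.mem_of_mem_head? hv
      simp only [SimpleGraph.deleteIncidenceSet_adj]
      grind [contractMatching]
    · rw [List.dropLast_concat] at hu
      have : v ∈ l ++ [m y] := List.mem_of_mem_tail hv
      have := hm u; have := hl u hu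
      simp only [SimpleGraph.deleteIncidenceSet_adj]
      grind [contractMatching]

end Contraction

section Counting

variable [Fintype W] {y z : W} {p : ℕ}

theorem exists_mem_isContractible [DecidableRel H.Adj] {T : Finset W} (hT : ∀ w ∈ T, m w ≠ w)
    (hy : m y ≠ y) (hcard : H.degree y + 2 < #T) : ∃ z ∈ T, IsContractible m H y z := by
  classical
  have hlt : #(insert y (insert (m y) (H.neighborFinset y))) < #T :=
    ((card_insert_le ..).trans (Nat.add_le_add_right (card_insert_le ..) 1)).trans_lt hcard
  obtain ⟨z, hz, hz'⟩ := exists_mem_notMem_of_card_lt_card hlt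
  simp only [mem_insert, SimpleGraph.mem_neighborFinset, not_or] at hz'
  exact ⟨z, hz, hy, hT z hz, hz'.1, hz'.2.1, hz'.2.2⟩

variable [DecidableEq W]

/-- The involution `m` is a matching with `p` edges which covers all vertices that are incident with
an edge of `H`. -/
structure IsCoveringMatching (m : W → W) (H : SimpleGraph W) (p : ℕ) : Prop where
  involutive : m.Involutive
  card_eq : #{w | m w ≠ w} = 2 * p
  support_subset : ∀ w ∈ H.support, m w ≠ w

theorem isCoveringMatching_of_forall_ne (hm : m.Involutive) (hne : ∀ w, m w ≠ w)
    (H : SimpleGraph W) (hp : Fintype.card W = 2 * p) : IsCoveringMatching m H p where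
  involutive := hm
  card_eq := by rw [filter_true_of_mem fun w _ => hne w, card_univ, hp]
  support_subset w _ := hne w

theorem IsContractible.isCoveringMatching_contractMatching (hyz : IsContractible m H y z)
    (h : IsCoveringMatching m H (p + 1)) :
    IsCoveringMatching (contractMatching m y z)
      ((H.deleteIncidenceSet y).deleteIncidenceSet z) p := by
  refine ⟨hyz.involutive_contractMatching h.involutive, ?_, fun w ⟨v, hwv⟩ => ?_⟩
  · have herase : ({w | contractMatching m y z w ≠ w} : Finset W) =
        ((univ.filter fun w => m w ≠ w).erase y).erase z := by
      ext w
      simp only [hyz.contractMatching_ne_iff h.involutive, mem_filter_univ, mem_erase]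
      tauto
    rw [herase, card_erase_of_mem (by simp [hyz.ne, hyz.right_ne]),
      card_erase_of_mem (by simp [hyz.left_ne]), h.card_eq]
    omega
  · simp only [SimpleGraph.deleteIncidenceSet_adj] at hwv
    rw [hyz.contractMatching_ne_iff h.involutive]
    exact ⟨h.support_subset w ⟨v, hwv.1.1⟩, hwv.1.2.1, hwv.2.1⟩

variable [DecidableRel H.Adj]

theorem card_edgeFinset_deleteIncidenceSet_deleteIncidenceSet_add (hyz : ¬ H.Adj y z)
    (hne : z ≠ y) :
    #((H.deleteIncidenceSet y).deleteIncidenceSet z).edgeFinset + (H.degree y + H.degree z) =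
      #H.edgeFinset := by
  have hdeg : (H.deleteIncidenceSet y).degree z = H.degree z := by
    simp only [← SimpleGraph.card_neighborFinset_eq_degree]
    congr 1
    ext w
    simp only [SimpleGraph.mem_neighborFinset, SimpleGraph.deleteIncidenceSet_adj]
    exact ⟨And.left, fun h => ⟨h, hne, fun hw => hyz (hw ▸ h.symm)⟩⟩
  have hy := H.degree_le_card_edgeFinset y
  have hz := (H.deleteIncidenceSet y).degree_le_card_edgeFinset z
  rw [SimpleGraph.card_edgeFinset_deleteIncidenceSet] at hz ⊢
  rw [SimpleGraph.card_edgeFinset_deleteIncidenceSet]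
  omega

namespace IsCoveringMatching

theorem exists_isContractible (h : IsCoveringMatching m H p) (hy : m y ≠ y)
    (hdeg : H.degree y + 2 < 2 * p) : ∃ z, IsContractible m H y z := by
  obtain ⟨z, -, hz⟩ := exists_mem_isContractible (T := {w | m w ≠ w}) (by simp) hy
    (h.card_eq ▸ hdeg)
  exact ⟨z, hz⟩

theorem ne_of_degree_pos (h : IsCoveringMatching m H p) (hy : 0 < H.degree y) : m y ≠ y :=
  h.support_subset y ((H.degree_pos_iff_mem_support y).1 hy)

theorem exists_isContractible_of_mul_lt (h : IsCoveringMatching m H p)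
    (hex : ∀ y, m y ≠ y → ∃ z, IsContractible m H y z) {d : ℕ} (hd : 0 < d)
    (hy : d ≤ H.degree y) (he : d * (d + 2) < 2 * #H.edgeFinset) :
    ∃ y z, IsContractible m H y z ∧ d < H.degree y + H.degree z := by
  by_cases! hlarge : ∃ w, d < H.degree w
  · obtain ⟨w, hw⟩ := hlarge
    obtain ⟨z, hz⟩ := hex w (h.ne_of_degree_pos (by omega))
    exact ⟨w, z, hz, by omega⟩
  have hsupport : d + 2 < #{w | 0 < H.degree w} := by
    refine lt_of_mul_lt_mul_left (he.trans_le ?_) d.zero_le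
    rw [← H.sum_degrees_eq_twice_card_edges,
      ← sum_filter_of_ne fun _ _ => Nat.pos_of_ne_zero, mul_comm]
    exact sum_le_card_nsmul _ _ _ fun w _ => hlarge w
  obtain ⟨z, hz, hyz⟩ := exists_mem_isContractible (T := {w | 0 < H.degree w})
    (fun w hw => h.ne_of_degree_pos (mem_filter_univ w |>.1 hw))
    (h.ne_of_degree_pos (by omega)) ((Nat.add_le_add_right (hlarge y) 2).trans_lt hsupport)
  rw [mem_filter_univ] at hz
  exact ⟨y, z, hyz, by omega⟩

theorem exists_lt_degree (h : IsCoveringMatching m H p) {d : ℕ} (he : d * p < #H.edgeFinset) :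
    ∃ y, d < H.degree y := by
  by_contra! hle
  refine he.not_ge ?_
  suffices 2 * #H.edgeFinset ≤ 2 * p * d by linarith
  rw [← H.sum_degrees_eq_twice_card_edges, ← h.card_eq,
    ← sum_filter_of_ne fun _ _ hw => h.ne_of_degree_pos (Nat.pos_of_ne_zero hw)]
  exact sum_le_card_nsmul _ _ _ fun w _ => hle w

theorem exists_isMatchingCycle_one (h : IsCoveringMatching m H 1) (he : #H.edgeFinset = 0) :
    ∃ s, IsMatchingCycle m H s := by
  obtain ⟨a, ha⟩ : ({w | m w ≠ w} : Finset W).Nonempty := by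
    rw [← card_pos, h.card_eq]; norm_num
  rw [mem_filter_univ] at ha
  have hpair : ({a, m a} : Finset W) = ({w | m w ≠ w} : Finset W) := by
    refine eq_of_subset_of_card_le ?_ (by rw [h.card_eq, card_pair ha.symm])
    simp [insert_subset_iff, ha, h.involutive a, ha.symm]
  refine ⟨([a] : List W), Cycle.nodup_coe_iff.2 (List.nodup_singleton a), fun w => ?_, ?_⟩
  · have hw : w = a ∨ w = m a ↔ m w ≠ w := by simpa using Finset.ext_iff.1 hpair w
    have := h.involutive w; have := h.involutive a
    simp only [Cycle.mem_coe_iff, List.mem_singleton]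
    grind
  · simp [SimpleGraph.edgeFinset_eq_empty.1 (card_eq_zero.1 he)]

theorem exists_isMatchingCycle_of_card_eq_zero (h : IsCoveringMatching m H p) (hp : 0 < p)
    (he : #H.edgeFinset = 0) : ∃ s, IsMatchingCycle m H s := by
  induction p, hp using Nat.le_induction generalizing m H with
  | base => exact h.exists_isMatchingCycle_one he
  | succ p hp ih =>
    obtain ⟨y, hy⟩ : ({w | m w ≠ w} : Finset W).Nonempty := by
      rw [← card_pos, h.card_eq]; omega
    obtain ⟨z, hyz⟩ := h.exists_isContractible (mem_filter_univ (p := fun w => m w ≠ w) y |>.1 hy)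
      (by have := H.degree_le_card_edgeFinset y; omega)
    have hcard := card_edgeFinset_deleteIncidenceSet_deleteIncidenceSet_add hyz.not_adj hyz.ne
    obtain ⟨s, hs⟩ := ih (hyz.isCoveringMatching_contractMatching h) (by omega)
    exact hs.exists_of_contractMatching h.involutive hyz

theorem exists_isContractible_le_degree_add (h : IsCoveringMatching m H p)
    (he : #H.edgeFinset + 3 ≤ 2 * p) (hpos : 0 < #H.edgeFinset) :
    ∃ y z, IsContractible m H y z ∧ min 2 #H.edgeFinset ≤ H.degree y + H.degree z := by
  obtain ⟨y, hy⟩ := h.exists_lt_degree (d := 0) (by omega)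
  have hex (y) (hy : m y ≠ y) : ∃ z, IsContractible m H y z :=
    h.exists_isContractible hy (by have := H.degree_le_card_edgeFinset y; omega)
  rcases (Nat.succ_le_of_lt hpos).eq_or_lt with hone | htwo
  · obtain ⟨z, hyz⟩ := hex y (h.ne_of_degree_pos hy)
    exact ⟨y, z, hyz, by omega⟩
  · obtain ⟨y, z, hyz, hdeg⟩ :=
      h.exists_isContractible_of_mul_lt hex one_pos hy (by omega)
    exact ⟨y, z, hyz, by omega⟩

theorem exists_isMatchingCycle_of_le_two_mul (h : IsCoveringMatching m H p)
    (he : #H.edgeFinset + 3 ≤ 2 * p) : ∃ s, IsMatchingCycle m H s := by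
  induction p generalizing m H with
  | zero => omega
  | succ p ih =>
    rcases (#H.edgeFinset).eq_zero_or_pos with hzero | hpos
    · exact h.exists_isMatchingCycle_of_card_eq_zero p.succ_pos hzero
    obtain ⟨y, z, hyz, hdeg⟩ := h.exists_isContractible_le_degree_add he hpos
    have hcard := card_edgeFinset_deleteIncidenceSet_deleteIncidenceSet_add hyz.not_adj hyz.ne
    have hcontract := hyz.isCoveringMatching_contractMatching h
    obtain ⟨s, hs⟩ : ∃ s, IsMatchingCycle (contractMatching m y z) _ s := by
      rcases (Nat.succ_le_of_lt hpos).eq_or_lt with hone | htwo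
      · exact hcontract.exists_isMatchingCycle_of_card_eq_zero (by omega) (by omega)
      · exact ih hcontract (by omega)
    exact hs.exists_of_contractMatching h.involutive hyz

theorem exists_isMatchingCycle_of_le_three_mul (h : IsCoveringMatching m H p)
    (hex : ∀ y, m y ≠ y → ∃ z, IsContractible m H y z) (he : #H.edgeFinset + 7 ≤ 3 * p) :
    ∃ s, IsMatchingCycle m H s := by
  induction p generalizing m H with
  | zero => omega
  | succ p ih =>
    by_cases! hfew : #H.edgeFinset + 3 ≤ 2 * (p + 1)
    · exact h.exists_isMatchingCycle_of_le_two_mul hfew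
    suffices hcontract : ∃ y z, IsContractible m H y z ∧
        ∃ s, IsMatchingCycle (contractMatching m y z)
          ((H.deleteIncidenceSet y).deleteIncidenceSet z) s by
      obtain ⟨y, z, hyz, s, hs⟩ := hcontract
      exact hs.exists_of_contractMatching h.involutive hyz
    -- Either contracting at one vertex already leaves few enough edges for the previous bound, or
    -- all degrees are so small that `hex` survives the contraction.
    by_cases! hlarge : ∃ y, p ≤ H.degree y
    · obtain ⟨y, hy⟩ := hlarge
      obtain ⟨z, hyz⟩ := hex y (h.ne_of_degree_pos (by omega))
      have hcard := card_edgeFinset_deleteIncidenceSet_deleteIncidenceSet_add hyz.not_adj hyz.ne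
      exact ⟨y, z, hyz,
        (hyz.isCoveringMatching_contractMatching h).exists_isMatchingCycle_of_le_two_mul
          (by omega)⟩
    obtain ⟨y, hy⟩ := h.exists_lt_degree (d := 1) (by omega)
    obtain ⟨y, z, hyz, hdeg⟩ := h.exists_isContractible_of_mul_lt hex two_pos hy (by omega)
    have hcard := card_edgeFinset_deleteIncidenceSet_deleteIncidenceSet_add hyz.not_adj hyz.ne
    have hcontract := hyz.isCoveringMatching_contractMatching h
    refine ⟨y, z, hyz, ih hcontract (fun w hw => hcontract.exists_isContractible hw ?_) (by omega)⟩
    have hle : ((H.deleteIncidenceSet y).deleteIncidenceSet z).degree w ≤ H.degree w :=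
      SimpleGraph.degree_le_of_le
        ((SimpleGraph.deleteIncidenceSet_le _ z).trans (H.deleteIncidenceSet_le y))
    have := hlarge w
    omega

end IsCoveringMatching

end Counting

end MatchingCycle

section Components

variable {U : Type*} {K : SimpleGraph U}

theorem compl_adj_of_connectedComponentMk_ne {u v : U}
    (h : K.connectedComponentMk u ≠ K.connectedComponentMk v) : Kᶜ.Adj u v :=
  (SimpleGraph.compl_adj K u v).2 ⟨fun huv => h (huv ▸ rfl),
    fun huv => h (SimpleGraph.ConnectedComponent.eq.2 huv.reachable)⟩

theorem exists_injective_connectedComponentMk_eq (K : SimpleGraph U) :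
    ∃ rep : K.ConnectedComponent → U, rep.Injective ∧ ∀ C, K.connectedComponentMk (rep C) = C := by
  choose rep hrep using fun C : K.ConnectedComponent => C.exists_rep
  exact ⟨rep, Function.LeftInverse.injective hrep, hrep⟩

variable [Fintype U]

theorem sum_ncard_supp_le_card (T : Finset K.ConnectedComponent) :
    ∑ C ∈ T, C.supp.ncard ≤ Fintype.card U := by
  classical
  simp only [Set.ncard_eq_toFinset_card']
  rw [← card_biUnion fun C _ D _ hCD => Set.disjoint_toFinset.2
    (SimpleGraph.pairwise_disjoint_supp_connectedComponent K hCD)]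
  exact card_le_univ _

variable [DecidableRel Kᶜ.Adj]

theorem card_le_degree_compl_add_ncard_supp (v : U) :
    Fintype.card U ≤ Kᶜ.degree v + (K.connectedComponentMk v).supp.ncard := by
  classical
  rw [Set.ncard_eq_toFinset_card', ← SimpleGraph.card_neighborFinset_eq_degree, ← card_univ]
  refine (card_le_card fun w _ => ?_).trans (card_union_le ..)
  by_cases hw : K.connectedComponentMk v = K.connectedComponentMk w
  · exact mem_union_right _ (Set.mem_toFinset.2 hw.symm)
  · exact mem_union_left _
      ((Kᶜ.mem_neighborFinset v w).2 (compl_adj_of_connectedComponentMk_ne hw))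

theorem card_le_degree_compl_add_one (T : Finset K.ConnectedComponent) (v : U) :
    #T ≤ Kᶜ.degree v + 1 := by
  classical
  suffices h : #(T.erase (K.connectedComponentMk v)) ≤ Kᶜ.degree v from
    tsub_le_iff_right.1 (pred_card_le_card_erase.trans h)
  rw [← SimpleGraph.card_neighborFinset_eq_degree]
  obtain ⟨rep, hinj, hrep⟩ := exists_injective_connectedComponentMk_eq K
  refine card_le_card_of_injOn rep (fun C hC => ?_) hinj.injOn
  rw [mem_coe, SimpleGraph.mem_neighborFinset]
  exact compl_adj_of_connectedComponentMk_ne ((ne_of_mem_erase hC).symm.trans_eq (hrep C).symm)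

theorem sub_one_mul_le_two_mul_card_edgeFinset_compl {k : ℕ}
    (hk : k ≤ Nat.card K.ConnectedComponent) :
    (k - 1) * (2 * Fintype.card U - k) ≤ 2 * #Kᶜ.edgeFinset := by
  classical
  rw [Nat.card_eq_fintype_card, ← card_univ] at hk
  obtain ⟨T, -, rfl⟩ := exists_subset_card_eq hk
  obtain ⟨rep, hinj, hrep⟩ := exists_injective_connectedComponentMk_eq K
  -- A representative is nonadjacent to everything outside its component, and any other vertex is
  -- nonadjacent to the representatives of at least `k - 1` components.
  let reps : Finset U := T.map ⟨rep, hinj⟩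
  have hcard : #T ≤ Fintype.card U := (card_map _).symm.trans_le (card_le_univ reps)
  have hreps : #T * Fintype.card U ≤ ∑ v ∈ reps, Kᶜ.degree v + Fintype.card U := by
    rw [sum_map, ← smul_eq_mul]
    refine (card_nsmul_le_sum T (fun C => Kᶜ.degree (rep C) + C.supp.ncard) _ fun C _ => ?_).trans
      (sum_add_distrib.trans_le (Nat.add_le_add_left (sum_ncard_supp_le_card T) _))
    simpa only [hrep C] using card_le_degree_compl_add_ncard_supp (K := K) (rep C)
  have hothers : (Fintype.card U - #T) * (#T - 1) ≤ ∑ v ∈ repsᶜ, Kᶜ.degree v := by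
    rw [← card_map ⟨rep, hinj⟩, ← card_compl, ← smul_eq_mul, card_map]
    exact card_nsmul_le_sum _ _ _ fun v _ => tsub_le_iff_right.2 (card_le_degree_compl_add_one T v)
  rw [← Kᶜ.sum_degrees_eq_twice_card_edges, ← sum_add_sum_compl reps]
  obtain ⟨r, hr⟩ := Nat.exists_eq_add_of_le hcard
  rcases (#T).eq_zero_or_pos with hT | hT
  · simp [hT]
  · obtain ⟨j, hj⟩ := Nat.exists_eq_add_of_le' hT
    rw [hr, hj] at hreps hothers ⊢
    rw [show 2 * (j + 1 + r) - (j + 1) = j + 1 + 2 * r by omega, Nat.add_sub_cancel]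
    rw [Nat.add_sub_cancel_left, Nat.add_sub_cancel] at hothers
    linarith

theorem ncard_supp_mul_le_card_edgeFinset_compl (C : K.ConnectedComponent) :
    C.supp.ncard * C.suppᶜ.ncard ≤ #Kᶜ.edgeFinset := by
  classical
  rw [Set.ncard_eq_toFinset_card', Set.ncard_eq_toFinset_card', ← card_product]
  refine card_le_card_of_injOn (fun p => s(p.1, p.2)) (fun p hp => ?_) fun p hp q hq hpq => ?_
  · simp only [coe_product, Set.mem_prod, mem_coe, Set.mem_toFinset, Set.mem_compl_iff,
      SimpleGraph.ConnectedComponent.mem_supp_iff] at hp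
    rw [mem_coe, SimpleGraph.mem_edgeFinset, SimpleGraph.mem_edgeSet]
    exact compl_adj_of_connectedComponentMk_ne (hp.1.trans_ne (Ne.symm hp.2))
  · simp only [coe_product, Set.mem_prod, mem_coe, Set.mem_toFinset, Set.mem_compl_iff] at hp hq
    grind

theorem three_mul_le_card_edgeFinset_compl {C D : K.ConnectedComponent} (hCD : C ≠ D)
    (hC : 3 ≤ C.supp.ncard) (hD : 3 ≤ D.supp.ncard) :
    3 * (Fintype.card U - 3) ≤ #Kᶜ.edgeFinset := by
  refine le_trans ?_ (ncard_supp_mul_le_card_edgeFinset_compl C)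
  have hDC : D.supp.ncard ≤ C.suppᶜ.ncard := Set.ncard_le_ncard
    (SimpleGraph.pairwise_disjoint_supp_connectedComponent K hCD).subset_compl_left
  have hcard := Set.ncard_add_ncard_compl C.supp
  rw [Nat.card_eq_fintype_card] at hcard
  obtain ⟨c, hc⟩ := Nat.exists_eq_add_of_le hC
  obtain ⟨d, hd⟩ := Nat.exists_eq_add_of_le (hD.trans hDC)
  rw [← hcard, hc, hd, show 3 + c + (3 + d) - 3 = 3 + c + d by omega]
  nlinarith [Nat.zero_le (c * d)]

end Components

section Tutte

variable {W : Type*} {G : SimpleGraph W}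

theorem exists_involutive_adj_of_isPerfectMatching {M : G.Subgraph} (hM : M.IsPerfectMatching) :
    ∃ m : W → W, m.Involutive ∧ ∀ w, G.Adj w (m w) := by
  rw [SimpleGraph.Subgraph.isPerfectMatching_iff] at hM
  choose m hm huniq using hM
  exact ⟨m, fun w => (huniq _ _ (hm w).symm).symm, fun w => (hm w).adj_sub⟩

theorem subset_of_two_le_ncard_oddComponents [Finite W] {Z S : Finset W}
    (hZ : ∀ z ∈ Z, ∀ w ≠ z, G.Adj z w)
    (hS : 2 ≤ (G.induce (↑S)ᶜ).oddComponents.ncard) : Z ⊆ S := by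
  intro z hz
  by_contra hzS
  obtain ⟨C, -, D, -, hCD⟩ := (Set.one_lt_ncard (Set.toFinite _)).1 hS
  have hmk (E : (G.induce (↑S : Set W)ᶜ).ConnectedComponent) :
      E = (G.induce (↑S : Set W)ᶜ).connectedComponentMk ⟨z, by simpa using hzS⟩ := by
    induction E using SimpleGraph.ConnectedComponent.ind with | h w => ?_
    by_cases hw : (w : W) = z
    · congr 1
      exact Subtype.ext hw
    · refine SimpleGraph.ConnectedComponent.eq.2 (SimpleGraph.Adj.reachable ?_)
      exact (hZ z hz w hw).symm
  exact hCD ((hmk C).trans (hmk D).symm)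

variable [Fintype W]

theorem exists_card_add_two_le_ncard_oddComponents (heven : Even (Fintype.card W))
    (hG : ∀ M : G.Subgraph, ¬ M.IsPerfectMatching) :
    ∃ S : Finset W, #S + 2 ≤ (G.induce (↑S)ᶜ).oddComponents.ncard := by
  obtain ⟨S, hS⟩ : ∃ S, G.IsTutteViolator S := by
    by_contra! h
    exact (not_exists.2 hG) (SimpleGraph.tutte.2 h)
  lift S to Finset W using S.toFinite
  refine ⟨S, ?_⟩
  rw [SimpleGraph.IsTutteViolator, Set.ncard_coe_finset] at hS
  change #S < (((⊤ : G.Subgraph).induce (Set.univ \ ↑S)).coe).oddComponents.ncard at hS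
  rw [← SimpleGraph.induce_eq_coe_induce_top, ← Set.compl_eq_univ_sdiff] at hS
  replace hS : #S < (G.induce (↑S)ᶜ).oddComponents.ncard := hS
  have hodd := (G.induce (↑S)ᶜ).odd_ncard_oddComponents
  have hcard := Set.ncard_add_ncard_compl (S : Set W)
  rw [Set.ncard_coe_finset, ← Nat.card_coe_set_eq, Nat.card_eq_fintype_card (α := W)] at hcard
  rw [Nat.odd_iff, Nat.odd_iff] at hodd
  rw [Nat.even_iff] at heven
  omega

theorem card_edgeFinset_compl_induce_le (S : Set W) [DecidableRel Gᶜ.Adj] [Fintype S]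
    [DecidableRel (G.induce S)ᶜ.Adj] : #(G.induce S)ᶜ.edgeFinset ≤ #Gᶜ.edgeFinset := by
  classical
  rw [SimpleGraph.edgeFinset_card, SimpleGraph.edgeFinset_card]
  exact Fintype.card_le_of_embedding
    (SimpleGraph.Embedding.complEquiv (SimpleGraph.Embedding.induce S)).mapEdgeSet

theorem three_le_ncard_supp {U : Type*} [Finite U] {K : SimpleGraph U} (hK : ∀ u, ∃ v, K.Adj u v)
    {C : K.ConnectedComponent} (hC : C ∈ K.oddComponents) : 3 ≤ C.supp.ncard := by
  induction C using SimpleGraph.ConnectedComponent.ind with | h u => ?_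
  obtain ⟨v, huv⟩ := hK u
  have htwo : 1 < (K.connectedComponentMk u).supp.ncard :=
    (Set.one_lt_ncard (Set.toFinite _)).2
      ⟨u, rfl, v, SimpleGraph.ConnectedComponent.eq.2 huv.symm.reachable, huv.ne⟩
  have hodd : Odd (K.connectedComponentMk u).supp.ncard := hC
  rw [Nat.odd_iff] at hodd
  omega

-- A Tutte violator with `s` vertices leaves at least `s + 2` components on the other vertices, so
-- at least `(s + 1) * (2 * card W - 3 * s - 2) / 2` edges are missing. If it is `Z` itself, there
-- are two components with at least three vertices, contradicting `hsmall`.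
theorem exists_involutive_adj [DecidableRel Gᶜ.Adj]
    (heven : Even (Fintype.card W)) {Z : Finset W}
    (hZ : ∀ z ∈ Z, ∀ w ≠ z, G.Adj z w) (hnbr : ∀ w ∉ Z, ∃ v ∉ Z, G.Adj w v)
    (hsmall : #Gᶜ.edgeFinset < 3 * (Fintype.card W - #Z - 3))
    (hlarge : ∀ s, #Z < s → 2 * s + 2 ≤ Fintype.card W →
      2 * #Gᶜ.edgeFinset < (s + 1) * (2 * Fintype.card W - 3 * s - 2)) :
    ∃ m : W → W, m.Involutive ∧ ∀ w, G.Adj w (m w) := by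
  classical
  by_contra hM
  obtain ⟨S, hS⟩ := exists_card_add_two_le_ncard_oddComponents heven
    fun M hM' => hM (exists_involutive_adj_of_isPerfectMatching hM')
  have hZS := subset_of_two_le_ncard_oddComponents hZ ((Nat.le_add_left 2 #S).trans hS)
  have hcard : Fintype.card ↥((S : Set W)ᶜ) = Fintype.card W - #S := by
    simp [← compl_filter, card_compl]
  have hle := card_edgeFinset_compl_induce_le (G := G) (S : Set W)ᶜ
  rcases (card_le_card hZS).eq_or_lt with heq | hlt
  · obtain rfl := eq_of_subset_of_card_le hZS heq.ge
    obtain ⟨C, hC, D, hD, hCD⟩ := (Set.one_lt_ncard (Set.toFinite _)).1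
      (show 1 < (G.induce (↑Z : Set W)ᶜ).oddComponents.ncard by omega)
    have hK (u : ↥((Z : Set W)ᶜ)) : ∃ v, (G.induce (↑Z : Set W)ᶜ).Adj u v := by
      obtain ⟨v, hv, huv⟩ := hnbr u (fun hu => u.2 (mem_coe.2 hu))
      exact ⟨⟨v, by simpa using hv⟩, huv⟩
    have := three_mul_le_card_edgeFinset_compl hCD (three_le_ncard_supp hK hC)
      (three_le_ncard_supp hK hD)
    omega
  · have hcomp : #S + 2 ≤ Nat.card (G.induce (↑S : Set W)ᶜ).ConnectedComponent :=
      hS.trans (Set.ncard_le_card _)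
    have hcomp' : Nat.card (G.induce (↑S : Set W)ᶜ).ConnectedComponent ≤ Fintype.card W - #S := by
      rw [← hcard, Nat.card_eq_fintype_card]
      exact Fintype.card_le_of_surjective _ Quot.mk_surjective
    have := sub_one_mul_le_two_mul_card_edgeFinset_compl hcomp
    have := hlarge #S hlt (by omega)
    rw [show 2 * Fintype.card ↥((S : Set W)ᶜ) - (#S + 2) = 2 * Fintype.card W - 3 * #S - 2 by omega,
      Nat.add_succ_sub_one] at *
    omega

end Tutte

namespace EdgeColouredMultigraph

section AlternatingLists

variable {V : Type*} {G : EdgeColouredMultigraph V (Fin 2)}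

/-- A list of vertices is alternating if any two consecutive vertices are joined by an edge, the
first of these edges having colour `c` and their colours alternating. -/
def IsAlternating (G : EdgeColouredMultigraph V (Fin 2)) : Fin 2 → List V → Prop
  | c, a :: b :: l => (G.colourClass c).Adj a b ∧ G.IsAlternating (c + 1) (b :: l)
  | _, _ => True

variable {c : Fin 2}

namespace IsAlternating

theorem tail {a : V} {l : List V} (h : G.IsAlternating c (a :: l)) :
    G.IsAlternating (c + 1) l := by
  cases l with
  | nil => trivial
  | cons b l => exact h.2

theorem of_append_left {l₁ l₂ : List V} (h : G.IsAlternating c (l₁ ++ l₂)) :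
    G.IsAlternating c l₁ := by
  induction l₁ generalizing c with
  | nil => trivial
  | cons a l ih =>
    cases l with
    | nil => trivial
    | cons b l => exact ⟨h.1, ih h.2⟩

theorem adj_getElem {l : List V} (h : G.IsAlternating c l) {i : ℕ} (hi : i + 1 < l.length) :
    (G.colourClass (c + i • (1 : Fin 2))).Adj l[i] l[i + 1] := by
  induction l generalizing c i with
  | nil => simp at hi
  | cons a l ih =>
    cases l with
    | nil => simp at hi
    | cons b l =>
      cases i with
      | zero => simpa using h.1
      | succ i =>
        have hadj := ih h.2 (Nat.lt_of_succ_lt_succ hi)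
        rw [add_assoc, ← succ_nsmul'] at hadj
        simpa using hadj

theorem of_map {W : Type*} {G' : EdgeColouredMultigraph W (Fin 2)} {f : V → W}
    (hf : ∀ c u v, (G'.colourClass c).Adj (f u) (f v) → (G.colourClass c).Adj u v) {l : List V}
    (h : G'.IsAlternating c (l.map f)) : G.IsAlternating c l := by
  induction l generalizing c with
  | nil => trivial
  | cons a l ih =>
    cases l with
    | nil => trivial
    | cons b l => exact ⟨hf _ _ _ h.1, ih h.2⟩

theorem hasProperHamiltonianPath {l : List V} (h : G.IsAlternating c l) (hl : l ≠ [])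
    (hnodup : l.Nodup) (hmem : ∀ x, x ∈ l) : G.HasProperHamiltonianPath := by
  obtain ⟨k, hk⟩ : ∃ k, l.length = k + 1 :=
    Nat.exists_eq_succ_of_ne_zero (mt List.eq_nil_of_length_eq_zero hl)
  refine ⟨k, fun i => l[(i : ℕ)], fun i => c + (i : ℕ) • (1 : Fin 2), ⟨fun i j hij => ?_,
    fun i => ?_, fun i j hij => ?_⟩, fun x => ?_⟩
  · exact Fin.ext (hnodup.getElem_inj_iff.1 hij)
  · simpa using h.adj_getElem (i := i) (by omega)
  · rw [← hij, succ_nsmul, ← add_assoc]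
    exact (add_ne_left.2 one_ne_zero).symm
  · obtain ⟨i, hi, rfl⟩ := List.getElem_of_mem (hmem x)
    exact ⟨⟨i, by omega⟩, rfl⟩

end IsAlternating

end AlternatingLists

end EdgeColouredMultigraph

section CutCycle

variable {W : Type*} {m : W → W} {a : W} {l : List W}

/-- The list of vertices obtained by traversing the matching cycle with entries `a :: l` from `m a`
to `a`: the matching edge between `a` and `m a`, at which the cycle is cut, is left out. -/
def cutCycle (m : W → W) (a : W) (l : List W) : List W :=
  m a :: (l.flatMap (fun x => [x, m x]) ++ [a])

theorem isAlternating_cons_flatMap {G : EdgeColouredMultigraph W (Fin 2)} {c : Fin 2} {b : W}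
    (hchain : (b :: (l ++ [a])).IsChain fun u v => (G.colourClass (c + 1)).Adj (m u) v)
    (hadj : ∀ x ∈ l, (G.colourClass c).Adj x (m x)) :
    G.IsAlternating (c + 1) (m b :: (l.flatMap (fun x => [x, m x]) ++ [a])) := by
  induction l generalizing b with
  | nil => exact ⟨(List.isChain_cons_cons.1 hchain).1, trivial⟩
  | cons x l ih =>
    rw [List.cons_append, List.isChain_cons_cons] at hchain
    have hc : c + 1 + 1 = c := by fin_cases c <;> rfl
    refine ⟨hchain.1, ?_, ?_⟩ <;> rw [hc]
    · exact hadj x List.mem_cons_self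
    · exact ih hchain.2 fun y hy => hadj y (List.mem_cons_of_mem _ hy)

namespace IsMatchingCycle

variable {H : SimpleGraph W}

theorem nodup_cutCycle (hm : m.Involutive) (h : IsMatchingCycle m H (a :: l : List W)) :
    (cutCycle m a l).Nodup := by
  have hperm : (cutCycle m a l).Perm ((a :: l).flatMap fun x => [x, m x]) :=
    ((List.perm_append_singleton _ _).cons _).trans (List.Perm.swap _ _ _)
  have hne {x : W} (hx : x ∈ a :: l) : m x ≠ x ∧ m x ∉ a :: l := (h.mem_iff x).1 hx
  rw [hperm.nodup_iff, List.nodup_flatMap]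
  refine ⟨fun x hx => by simpa using (hne hx).1.symm, (Cycle.nodup_coe_iff.1 h.nodup).imp_of_mem
    fun {x y} hx hy hxy => ?_⟩
  have hxy' : x ≠ m y := fun hxy' => (hne hy).2 (hxy' ▸ hx)
  have hyx' : y ≠ m x := fun hyx' => (hne hx).2 (hyx' ▸ hy)
  simp [Function.onFun, hxy.symm, hm.injective.eq_iff, hxy'.symm, hyx']

theorem mem_cutCycle_iff (hm : m.Involutive) (h : IsMatchingCycle m H (a :: l : List W)) (w : W) :
    w ∈ cutCycle m a l ↔ m w ≠ w := by
  have hmem := h.mem_iff w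
  have hmem' := h.mem_iff (m w)
  have hflat : w ∈ l.flatMap (fun x => [x, m x]) ↔ w ∈ l ∨ m w ∈ l := by
    simp only [List.mem_flatMap, List.mem_cons, List.not_mem_nil, or_false]
    exact ⟨by rintro ⟨x, hx, rfl | rfl⟩ <;> simp [hx, hm _],
      by rintro (hw | hw); exacts [⟨w, hw, .inl rfl⟩, ⟨m w, hw, .inr (hm w).symm⟩]⟩
  have ha : w = m a ↔ m w = a := ⟨fun hw => hw ▸ hm a, fun hw => hw ▸ (hm w).symm⟩
  simp only [Cycle.mem_coe_iff, List.mem_cons] at hmem hmem'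
  rw [hm w] at hmem'
  simp only [cutCycle, List.mem_cons, List.mem_append, hflat, ha, List.not_mem_nil, or_false]
  grind

variable {G : EdgeColouredMultigraph W (Fin 2)} {c : Fin 2}

theorem isAlternating_cutCycle
    (h : IsMatchingCycle m (G.colourClass (c + 1))ᶜ (a :: l : List W))
    (hadj : ∀ x ∈ l, (G.colourClass c).Adj x (m x)) :
    G.IsAlternating (c + 1) (cutCycle m a l) := by
  refine isAlternating_cons_flatMap (isChain_imp_of_mem_dropLast (fun u hu v hv huv => ?_)
    ((Cycle.chain_coe_cons _ a l).1 h.chain)) hadj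
  have hmu : m u ∉ a :: l :=
    ((h.mem_iff u).1 (by rwa [← List.cons_append, List.dropLast_concat] at hu)).2
  by_contra hadj'
  refine huv ((SimpleGraph.compl_adj ..).2 ⟨fun huv' => hmu ?_, hadj'⟩)
  rw [huv', List.mem_cons]
  simpa [or_comm] using hv

end IsMatchingCycle

end CutCycle

namespace EdgeColouredMultigraph

section Universal

variable {V D : Type*}

/-- The number of pairs of vertices that are not joined by an edge of colour `c`. -/
noncomputable def numMissing {C : Type*} (G : EdgeColouredMultigraph V C) (c : C) : ℕ :=
  (G.colourClass c)ᶜ.edgeSet.ncard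

theorem card_edgeFinset_compl_colourClass {C : Type*} (G : EdgeColouredMultigraph V C) (c : C)
    [Fintype (G.colourClass c)ᶜ.edgeSet] : #(G.colourClass c)ᶜ.edgeFinset = G.numMissing c := by
  rw [numMissing, ← SimpleGraph.coe_edgeFinset, Set.ncard_coe_finset]

/-- The multigraph obtained by adding the elements of `D` as new vertices, which are joined to all
other vertices in all colours. It is defined by its non-edges, which are those of `G`. -/
def addUniversal {C : Type*} (G : EdgeColouredMultigraph V C) (D : Type*) :
    EdgeColouredMultigraph (V ⊕ D) C where
  colourClass c := ((G.colourClass c)ᶜ ⊕g (⊥ : SimpleGraph D))ᶜ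

section

variable {C : Type*} {G : EdgeColouredMultigraph V C} {c : C}

theorem addUniversal_adj_inl {u v : V} :
    ((G.addUniversal D).colourClass c).Adj (.inl u) (.inl v) ↔ (G.colourClass c).Adj u v := by
  rw [addUniversal, SimpleGraph.compl_adj, SimpleGraph.sum_adj_inl,
    Sum.inl_injective.ne_iff, ← SimpleGraph.compl_adj, compl_compl]

theorem addUniversal_adj_inr {d : D} {w : V ⊕ D} (hw : w ≠ .inr d) :
    ((G.addUniversal D).colourClass c).Adj (.inr d) w := by
  rw [addUniversal, SimpleGraph.compl_adj]
  exact ⟨hw.symm, by cases w <;> simp⟩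

theorem not_compl_addUniversal_adj_inr {d : D} {w : V ⊕ D} :
    ¬ ((G.addUniversal D).colourClass c)ᶜ.Adj (.inr d) w := fun h =>
  ((SimpleGraph.compl_adj ..).1 h).2 (addUniversal_adj_inr h.ne')

theorem numMissing_addUniversal [Finite V] [Finite D] :
    (G.addUniversal D).numMissing c = G.numMissing c := by
  rw [numMissing, addUniversal, compl_compl, ← Nat.card_coe_set_eq,
    Nat.card_congr SimpleGraph.edgeSetSumEquiv, Nat.card_sum]
  simp [numMissing]

end

variable {G : EdgeColouredMultigraph V (Fin 2)} {c : Fin 2}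

theorem IsAlternating.hasProperHamiltonianPath_of_addUniversal [Nonempty V] {l : List (V ⊕ D)}
    (h : (G.addUniversal D).IsAlternating c l) (hnodup : l.Nodup)
    (hmem : ∀ w, w ∈ l ↔ w.isLeft) : G.HasProperHamiltonianPath := by
  obtain ⟨l, rfl⟩ : l ∈ Set.range (List.map Sum.inl) := by
    rw [Set.range_list_map]
    exact fun w hw => (Sum.isLeft_iff.1 ((hmem w).1 hw)).imp fun _ => Eq.symm
  have hall (v : V) : v ∈ l := by simpa using hmem (.inl v)
  exact (h.of_map fun _ _ _ => addUniversal_adj_inl.1).hasProperHamiltonianPath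
    (List.ne_nil_of_mem (hall (Classical.arbitrary V))) hnodup.of_map hall

end Universal

end EdgeColouredMultigraph

theorem choose_two_eq_choose_two_sub_three_add {n : ℕ} (hn : 3 ≤ n) :
    n.choose 2 = (n - 3).choose 2 + (3 * n - 6) := by
  obtain ⟨k, rfl⟩ := Nat.exists_eq_add_of_le' hn
  have hsucc (i : ℕ) : (i + 1).choose 2 = i + i.choose 2 := by
    rw [Nat.choose_succ_succ' i 1, Nat.choose_one_right]
  rw [Nat.add_sub_cancel, hsucc, hsucc, hsucc]
  omega

theorem two_mul_lt_succ_mul_of_add_le {n e r s : ℕ} (hn : 14 ≤ n) (he : e + 10 ≤ 3 * n)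
    (hr : 1 ≤ r) (hr' : r ≤ 2) (hs : r < s) (hsn : 2 * s + 2 ≤ n + r) :
    2 * e < (s + 1) * (2 * (n + r) - 3 * s - 2) := by
  obtain ⟨t, ht⟩ := Nat.exists_eq_add_of_le hsn
  rw [show 2 * (n + r) - 3 * s - 2 = s + 2 + 2 * t by omega]
  rcases le_or_gt s 7 with hs' | hs'
  · interval_cases s <;> omega
  · have : 2 * e ≤ 12 * s + 6 * t := by omega
    nlinarith

theorem two_mul_lt_succ_mul_of_lt {n e s : ℕ} (hn : 14 ≤ n) (he : 2 * e + 10 < 4 * n)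
    (hs : 0 < s) (hsn : 2 * s + 2 ≤ n) : 2 * e < (s + 1) * (2 * n - 3 * s - 2) := by
  obtain ⟨t, ht⟩ := Nat.exists_eq_add_of_le hsn
  rw [show 2 * n - 3 * s - 2 = s + 2 + 2 * t by omega]
  rcases le_or_gt s 7 with hs' | hs'
  · interval_cases s <;> omega
  · have : 2 * e ≤ 8 * s + 4 * t := by omega
    nlinarith

namespace EdgeColouredMultigraph

section Existence

variable {V D : Type*} [Fintype V] {G : EdgeColouredMultigraph V (Fin 2)} {c : Fin 2}

theorem exists_involutive_addUniversal_adj [Fintype D] (hn : 14 ≤ Fintype.card V)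
    (hD : 1 ≤ Fintype.card D) (hD' : Fintype.card D ≤ 2)
    (heven : Even (Fintype.card V + Fintype.card D)) (hdeg : ∀ x, ∃ y, (G.colourClass c).Adj x y)
    (hmiss : G.numMissing c + 10 ≤ 3 * Fintype.card V) :
    ∃ m : V ⊕ D → V ⊕ D, m.Involutive ∧ ∀ w, ((G.addUniversal D).colourClass c).Adj w (m w) := by
  classical
  have hcard : #(univ.map (.inr : D ↪ V ⊕ D)) = Fintype.card D := card_map _
  rw [← Fintype.card_sum] at heven
  refine exists_involutive_adj heven (Z := univ.map .inr) (fun z hz w hw => ?_)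
    (fun w hw => ?_) ?_ fun s hs hsn => ?_
  · obtain ⟨d, -, rfl⟩ := mem_map.1 hz
    exact addUniversal_adj_inr hw
  · rcases w with v | d
    · obtain ⟨y, hy⟩ := hdeg v
      exact ⟨.inl y, by simp, addUniversal_adj_inl.2 hy⟩
    · simp at hw
  · rw [card_edgeFinset_compl_colourClass, numMissing_addUniversal, hcard, Fintype.card_sum]
    omega
  · rw [card_edgeFinset_compl_colourClass, numMissing_addUniversal, Fintype.card_sum]
    rw [hcard] at hs
    rw [Fintype.card_sum] at hsn
    exact two_mul_lt_succ_mul_of_add_le hn hmiss hD hD' hs hsn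

theorem exists_involutive_colourClass_adj (hn : 14 ≤ Fintype.card V)
    (heven : Even (Fintype.card V)) (hdeg : ∀ x, ∃ y, (G.colourClass c).Adj x y)
    (hmiss : 2 * G.numMissing c + 10 < 4 * Fintype.card V) :
    ∃ m : V → V, m.Involutive ∧ ∀ v, (G.colourClass c).Adj v (m v) := by
  classical
  refine exists_involutive_adj heven (Z := ∅) (by simp) (by simpa using hdeg) ?_ fun s hs hsn => ?_
  · rw [card_edgeFinset_compl_colourClass, card_empty]
    omega
  · rw [card_edgeFinset_compl_colourClass]
    exact two_mul_lt_succ_mul_of_lt hn hmiss (by simpa using hs) hsn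

theorem exists_isMatchingCycle_addUniversal [Fintype D] (d : D) (hn : 14 ≤ Fintype.card V)
    {m : V ⊕ D → V ⊕ D} (heven : Even (Fintype.card V + Fintype.card D)) (hm : m.Involutive)
    (hadj : ∀ w, ((G.addUniversal D).colourClass c).Adj w (m w))
    (hdeg : ∀ x, ∃ y, (G.colourClass (c + 1)).Adj x y)
    (hmiss : 2 * G.numMissing (c + 1) + 10 ≤ 3 * Fintype.card V) :
    ∃ s, IsMatchingCycle m ((G.addUniversal D).colourClass (c + 1))ᶜ s := by
  classical
  obtain ⟨p, hp⟩ := heven.two_dvd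
  have hD : 0 < Fintype.card D := Fintype.card_pos_iff.2 ⟨d⟩
  have h := isCoveringMatching_of_forall_ne hm (fun w => (hadj w).ne')
    ((G.addUniversal D).colourClass (c + 1))ᶜ (Fintype.card_sum.trans hp)
  refine h.exists_isMatchingCycle_of_le_three_mul (fun y hy => ?_) ?_
  · rcases y with v | d'
    · by_cases hv : m (.inl v) = .inr d
      · obtain ⟨x, hx⟩ := hdeg v
        refine ⟨.inl x, hy, (hadj _).ne', by simpa using hx.ne', by simp [hv], fun hvx => ?_⟩
        exact ((SimpleGraph.compl_adj ..).1 hvx).2 (addUniversal_adj_inl.2 hx)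
      · exact ⟨.inr d, hy, (hadj _).ne', by simp, Ne.symm hv,
          fun hvd => not_compl_addUniversal_adj_inr hvd.symm⟩
    · refine h.exists_isContractible hy ?_
      rw [show SimpleGraph.degree _ (Sum.inr d') = 0 from
        card_eq_zero.2 (eq_empty_of_forall_notMem fun w hw => not_compl_addUniversal_adj_inr
          ((SimpleGraph.mem_neighborFinset ..).1 hw))]
      omega
  · rw [card_edgeFinset_compl_colourClass, numMissing_addUniversal]
    omega

theorem hasProperHamiltonianPath_of_odd (hn : 14 ≤ Fintype.card V) (hodd : Odd (Fintype.card V))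
    (hdeg : ∀ c x, ∃ y, (G.colourClass c).Adj x y)
    (hmiss : G.numMissing c + 10 ≤ 3 * Fintype.card V)
    (hmiss' : 2 * G.numMissing (c + 1) + 10 ≤ 3 * Fintype.card V) :
    G.HasProperHamiltonianPath := by
  have : Nonempty V := Fintype.card_pos_iff.1 (by omega)
  have heven : Even (Fintype.card V + Fintype.card Unit) := hodd.add_one
  obtain ⟨m, hm, hadj⟩ := exists_involutive_addUniversal_adj hn (D := Unit) le_rfl one_le_two
    heven (hdeg c) hmiss
  obtain ⟨s, hs⟩ := exists_isMatchingCycle_addUniversal () hn heven hm hadj (hdeg (c + 1)) hmiss'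
  obtain ⟨l, hl⟩ := hs.exists_cons hm (b := .inr ()) (hadj _).ne'
  have halt := hl.isAlternating_cutCycle fun x _ => hadj x
  have hnodup := hl.nodup_cutCycle hm
  have hmem (w : V ⊕ Unit) : w ∈ cutCycle m (.inr ()) l := (hl.mem_cutCycle_iff hm w).2 (hadj w).ne'
  simp only [cutCycle, ← List.cons_append] at halt hnodup hmem
  rw [← List.concat_eq_append, List.nodup_concat] at hnodup
  refine halt.of_append_left.hasProperHamiltonianPath_of_addUniversal hnodup.2 fun w => ?_
  have hw := hmem w
  rcases w with v | u
  · simpa using hw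
  · simpa using hnodup.1

theorem hasProperHamiltonianPath_of_apply_inr_eq (hn : 14 ≤ Fintype.card V)
    (heven : Even (Fintype.card V)) {m : V ⊕ Fin 2 → V ⊕ Fin 2} (hm : m.Involutive)
    (hadj : ∀ w, ((G.addUniversal (Fin 2)).colourClass c).Adj w (m w)) (hm0 : m (.inr 0) = .inr 1)
    (hdeg : ∀ x, ∃ y, (G.colourClass (c + 1)).Adj x y)
    (hmiss : 2 * G.numMissing (c + 1) + 10 ≤ 3 * Fintype.card V) :
    G.HasProperHamiltonianPath := by
  have : Nonempty V := Fintype.card_pos_iff.1 (by omega)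
  obtain ⟨s, hs⟩ := exists_isMatchingCycle_addUniversal (0 : Fin 2) hn
    (heven.add even_two) hm hadj hdeg hmiss
  obtain ⟨l, hl⟩ := hs.exists_cons hm (b := .inr 0) (hadj _).ne'
  have halt := hl.isAlternating_cutCycle fun x _ => hadj x
  have hnodup := hl.nodup_cutCycle hm
  have hmem (w : V ⊕ Fin 2) : w ∈ cutCycle m (.inr 0) l := (hl.mem_cutCycle_iff hm w).2 (hadj w).ne'
  simp only [cutCycle, hm0] at halt hnodup hmem
  rw [← List.concat_eq_append, List.nodup_cons, List.nodup_concat, List.concat_eq_append,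
    List.mem_append, not_or] at hnodup
  refine halt.tail.of_append_left.hasProperHamiltonianPath_of_addUniversal hnodup.2.2 fun w => ?_
  have hw := hmem w
  rcases w with v | i
  · simpa using hw
  · fin_cases i
    · simpa using hnodup.2.1
    · simpa using hnodup.1.1

theorem exists_isMatchingCycle_contractMatching_addUniversal [DecidableEq V]
    (heven : Even (Fintype.card V)) {m : V ⊕ Fin 2 → V ⊕ Fin 2} (hm : m.Involutive)
    (hne : ∀ w, m w ≠ w)
    (hcon : IsContractible m ((G.addUniversal (Fin 2)).colourClass c)ᶜ (.inr 0) (.inr 1))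
    (hmiss : G.numMissing c + 5 ≤ Fintype.card V) :
    ∃ s, IsMatchingCycle (contractMatching m (.inr 0) (.inr 1))
      ((G.addUniversal (Fin 2)).colourClass c)ᶜ s := by
  classical
  let H := ((G.addUniversal (Fin 2)).colourClass c)ᶜ
  have hH (i : Fin 2) (w : V ⊕ Fin 2) : ¬ H.Adj (.inr i) w := not_compl_addUniversal_adj_inr
  obtain ⟨p, hp⟩ := heven.two_dvd
  have hcov := hcon.isCoveringMatching_contractMatching
    (isCoveringMatching_of_forall_ne hm hne H (p := p + 1)
      (by rw [Fintype.card_sum, Fintype.card_fin, hp, mul_add_one]))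
  have hdel : (H.deleteIncidenceSet (.inr 0)).deleteIncidenceSet (.inr 1) = H := by
    ext u v
    simp only [SimpleGraph.deleteIncidenceSet_adj]
    refine ⟨fun h => h.1.1, fun h => ⟨⟨h, ?_, ?_⟩, ?_, ?_⟩⟩ <;> rintro rfl
    exacts [hH _ _ h, hH _ _ h.symm, hH _ _ h, hH _ _ h.symm]
  rw [hdel] at hcov
  refine hcov.exists_isMatchingCycle_of_le_two_mul ?_
  rw [card_edgeFinset_compl_colourClass, numMissing_addUniversal]
  omega

theorem hasProperHamiltonianPath_of_apply_inr_ne (heven : Even (Fintype.card V))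
    {m : V ⊕ Fin 2 → V ⊕ Fin 2} (hm : m.Involutive)
    (hadj : ∀ w, ((G.addUniversal (Fin 2)).colourClass c).Adj w (m w)) (hm0 : m (.inr 0) ≠ .inr 1)
    (hmiss : G.numMissing (c + 1) + 5 ≤ Fintype.card V) : G.HasProperHamiltonianPath := by
  classical
  have : Nonempty V := Fintype.card_pos_iff.1 (by omega)
  have hne (w : V ⊕ Fin 2) : m w ≠ w := (hadj w).ne'
  have hcon : IsContractible m ((G.addUniversal (Fin 2)).colourClass (c + 1))ᶜ
      (.inr 0) (.inr 1) :=
    ⟨hne _, hne _, by simp, hm0.symm, not_compl_addUniversal_adj_inr⟩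
  obtain ⟨s, hs⟩ := exists_isMatchingCycle_contractMatching_addUniversal heven hm hne hcon hmiss
  have hm' := hcon.involutive_contractMatching hm
  have hmoved (w : V ⊕ Fin 2) : contractMatching m (.inr 0) (.inr 1) w ≠ w ↔ w.isLeft := by
    rw [hcon.contractMatching_ne_iff hm]
    rcases w with v | i
    · simp [hne]
    · fin_cases i <;> simp
  obtain ⟨l, hl⟩ := hs.exists_cons hm' (b := m (.inr 0))
    ((hcon.contractMatching_ne_iff hm).2 ⟨hne _, hne _, hm0⟩)
  refine (hl.isAlternating_cutCycle fun x hx => ?_).hasProperHamiltonianPath_of_addUniversal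
    (hl.nodup_cutCycle hm') fun w => (hl.mem_cutCycle_iff hm' w).trans (hmoved w)
  suffices hx' : contractMatching m (.inr 0) (.inr 1) x = m x from hx' ▸ hadj x
  have hxa : x ≠ m (.inr 0) := fun h => (List.nodup_cons.1 hl.nodup).1 (h ▸ hx)
  have hxs := (hl.mem_iff x).1 (List.mem_cons_of_mem _ hx)
  have hx01 := ((hcon.contractMatching_ne_iff hm).1 hxs.1).2
  have hxb : x ≠ m (.inr 1) := by
    rintro rfl
    exact hxs.2 (hcon.contractMatching_apply_right hm ▸ List.mem_cons_self)
  simp [contractMatching, hx01, hxa, hxb]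

theorem hasProperHamiltonianPath_of_even (hn : 14 ≤ Fintype.card V)
    (heven : Even (Fintype.card V)) (hdeg : ∀ c x, ∃ y, (G.colourClass c).Adj x y)
    (hmiss : G.numMissing c + G.numMissing (c + 1) + 10 ≤ 3 * Fintype.card V)
    (hle : G.numMissing (c + 1) ≤ G.numMissing c) : G.HasProperHamiltonianPath := by
  obtain ⟨m, hm, hadj⟩ := exists_involutive_addUniversal_adj hn (D := Fin 2) one_le_two le_rfl
    (heven.add even_two) (hdeg c) (by omega)
  by_cases hm0 : m (.inr 0) = .inr 1
  · exact hasProperHamiltonianPath_of_apply_inr_eq hn heven hm hadj hm0 (hdeg _) (by omega)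
  -- The contracted cycle needs `n - 5` missing edges at most in colour `c + 1`; if there are more,
  -- then colour `c` misses so few edges that it has a perfect matching without the new vertices.
  by_cases hfew : 2 * G.numMissing c + 10 < 4 * Fintype.card V
  · obtain ⟨m, hm, hadj⟩ := exists_involutive_colourClass_adj hn heven (hdeg c) hfew
    refine hasProperHamiltonianPath_of_apply_inr_eq hn heven (c := c)
      (m := Sum.map m (Equiv.swap 0 1)) ?_ ?_ rfl (hdeg _) (by omega)
    · rintro (v | i)
      · exact congrArg Sum.inl (hm v)
      · exact congrArg Sum.inr (Equiv.swap_apply_self 0 1 i)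
    · rintro (v | i)
      · exact addUniversal_adj_inl.2 (hadj v)
      · refine addUniversal_adj_inr ?_
        fin_cases i <;> simp
  · exact hasProperHamiltonianPath_of_apply_inr_ne heven hm hadj hm0 (by omega)

theorem hasProperHamiltonianPath_of_numMissing_add_le (hn : 14 ≤ Fintype.card V)
    (hdeg : ∀ c x, ∃ y, (G.colourClass c).Adj x y)
    (hmiss : G.numMissing c + G.numMissing (c + 1) + 10 ≤ 3 * Fintype.card V) :
    G.HasProperHamiltonianPath := by
  wlog hle : G.numMissing (c + 1) ≤ G.numMissing c generalizing c
  · have hc : c + 1 + 1 = c := by fin_cases c <;> rfl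
    exact this (c := c + 1) (by rwa [hc, add_comm (G.numMissing _)]) (by rw [hc]; omega)
  rcases Nat.even_or_odd (Fintype.card V) with heven | hodd
  · exact hasProperHamiltonianPath_of_even hn heven hdeg hmiss hle
  · exact hasProperHamiltonianPath_of_odd (c := c) hn hodd hdeg (by omega) (by omega)

theorem numEdges_add_numMissing (G : EdgeColouredMultigraph V (Fin 2)) :
    G.numEdges + (G.numMissing 0 + G.numMissing 1) = 2 * (Fintype.card V).choose 2 := by
  have hcompl (c : Fin 2) :
      (G.colourClass c).edgeSet.ncard + G.numMissing c = (Fintype.card V).choose 2 := by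
    classical
    rw [numMissing, ← Set.ncard_union_eq ((SimpleGraph.disjoint_edgeSet).2 disjoint_compl_right),
      ← SimpleGraph.edgeSet_sup, sup_compl_eq_top, ← SimpleGraph.coe_edgeFinset,
      Set.ncard_coe_finset, SimpleGraph.card_edgeFinset_top_eq_card_choose_two]
  rw [numEdges, Fin.sum_univ_two]
  linarith [hcompl 0, hcompl 1]

theorem hasProperHamiltonianPath_of_le_numEdges (hn : 14 ≤ Fintype.card V)
    (hdeg : ∀ c x, ∃ y, (G.colourClass c).Adj x y)
    (hedges : (Fintype.card V).choose 2 + (Fintype.card V - 3).choose 2 + 4 ≤ G.numEdges) :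
    G.HasProperHamiltonianPath := by
  have hadd := G.numEdges_add_numMissing
  have hchoose := choose_two_eq_choose_two_sub_three_add (n := Fintype.card V) (by omega)
  exact hasProperHamiltonianPath_of_numMissing_add_le (c := 0) hn hdeg (by
    rw [zero_add]; omega)

end Existence

theorem exists_colourClass_adj_of_rainbowDegree_eq_two {V : Type*}
    {G : EdgeColouredMultigraph V (Fin 2)} (h : G.rainbowDegree = 2) (c : Fin 2) (x : V) :
    ∃ y, (G.colourClass c).Adj x y := by
  have hx : 2 ≤ G.vertexRainbowDegree x := h.ge.trans (ciInf_le (OrderBot.bddBelow _) x)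
  have huniv : {i : Fin 2 | ∃ y : V, (G.colourClass i).Adj x y} = Set.univ := by
    refine Set.eq_of_subset_of_ncard_le (Set.subset_univ _) ?_
    rwa [Set.ncard_univ, Nat.card_eq_fintype_card, Fintype.card_fin]
  exact Set.eq_univ_iff_forall.1 huniv c

section NearPerfectMatching

variable {V : Type*} {G : EdgeColouredMultigraph V (Fin 2)}

theorem IsProperPath.exists_forall_colour_eq {k : ℕ} {v : Fin (k + 1) → V} {c : Fin k → Fin 2}
    (h : G.IsProperPath v c) (a : Fin 2) :
    ∃ r < 2, ∀ i : Fin k, (i : ℕ) % 2 = r → c i = a := by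
  have heq_iff (i j : Fin k) (hij : (i : ℕ) + 1 = j) : c j = a ↔ c i ≠ a := by
    have := h.proper i j hij
    omega
  have hall (i : ℕ) (hi : i < k) :
      c ⟨i, hi⟩ = a ↔ (i % 2 = 0 ↔ c ⟨0, Nat.zero_lt_of_lt hi⟩ = a) := by
    induction i with
    | zero => simp
    | succ i ih =>
      rw [heq_iff ⟨i, by omega⟩ ⟨i + 1, hi⟩ rfl, ne_eq, ih (by omega),
        show (i + 1) % 2 = 0 ↔ ¬ i % 2 = 0 by omega]
      tauto
  by_cases h0 : ∃ hk : 0 < k, c ⟨0, hk⟩ ≠ a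
  · obtain ⟨hk, h0⟩ := h0
    exact ⟨1, one_lt_two, fun i hi => (hall i i.2).2 (by simp [h0, hi])⟩
  · push Not at h0
    exact ⟨0, two_pos, fun i hi => (hall i i.2).2 (by simp [h0, hi])⟩

theorem IsProperPath.exists_involutive_adj {k : ℕ} {v : Fin (k + 1) → V} {c : Fin k → Fin 2}
    (h : G.IsProperPath v c) (hk : Even k) (a : Fin 2) :
    ∃ (e : Fin (k + 1)) (f : Fin (k + 1) → Fin (k + 1)), f.Involutive ∧
      ∀ j ≠ e, (G.colourClass a).Adj (v j) (v (f j)) := by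
  obtain ⟨r, hr, hc⟩ := h.exists_forall_colour_eq a
  rw [Nat.even_iff] at hk
  have hadj (j j' : Fin (k + 1)) (hj : (j : ℕ) % 2 = r) (hjj' : (j : ℕ) + 1 = j') :
      (G.colourClass a).Adj (v j) (v j') := by
    have hij := h.adj ⟨j, by omega⟩
    rw [hc _ hj] at hij
    rwa [show j' = Fin.succ ⟨j, by omega⟩ from Fin.ext hjj'.symm]
  -- The truncations fix the end vertices that have no neighbour on the path in colour `a`.
  let f (j : Fin (k + 1)) : Fin (k + 1) :=
    if (j : ℕ) % 2 = r then ⟨min (j + 1) k, by omega⟩ else ⟨j - 1, by omega⟩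
  have hval (j : Fin (k + 1)) :
      (f j : ℕ) = if (j : ℕ) % 2 = r then min ((j : ℕ) + 1) k else j - 1 := by
    simp only [f]
    split_ifs <;> rfl
  refine ⟨if r = 0 then Fin.last k else 0, f, fun j => Fin.ext ?_, fun j hj => ?_⟩
  · simp only [hval]
    split_ifs <;> omega
  have hinner : (j : ℕ) % 2 = r ∧ (j : ℕ) < k ∨ (j : ℕ) % 2 ≠ r ∧ 0 < (j : ℕ) := by
    split_ifs at hj <;> simp only [ne_eq, Fin.ext_iff, Fin.val_last, Fin.val_zero] at hj <;> omega
  rcases hinner with ⟨hjr, hjk⟩ | ⟨hjr, hj0⟩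
  · exact hadj j _ hjr (by rw [hval, if_pos hjr]; omega)
  · exact (hadj _ j (by rw [hval, if_neg hjr]; omega) (by rw [hval, if_neg hjr]; omega)).symm

theorem HasProperHamiltonianPath.exists_involutive_adj [Fintype V]
    (h : G.HasProperHamiltonianPath) (hodd : Odd (Fintype.card V)) (a : Fin 2) :
    ∃ (e : V) (f : V → V), f.Involutive ∧ ∀ x ≠ e, (G.colourClass a).Adj x (f x) := by
  obtain ⟨k, v, c, hP, hsurj⟩ := h
  let φ : Fin (k + 1) ≃ V := Equiv.ofBijective v ⟨hP.injective, hsurj⟩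
  have hk : Even k := by
    rwa [← Fintype.card_congr φ, Fintype.card_fin, Nat.odd_add_one, Nat.not_odd_iff_even] at hodd
  obtain ⟨e, f, hf, hadj⟩ := hP.exists_involutive_adj hk a
  refine ⟨φ e, fun x => φ (f (φ.symm x)), fun x => by simp [hf _], fun x hx => ?_⟩
  have := hadj (φ.symm x) fun hxe => hx ((φ.symm_apply_eq).1 hxe)
  rwa [show v (φ.symm x) = x from φ.apply_symm_apply x] at this

theorem not_hasProperHamiltonianPath_of_forall_adj_eq [Fintype V] (hodd : Odd (Fintype.card V))
    {a : Fin 2} {S : Finset V} (hS : 2 < #S) {w : V}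
    (hw : ∀ x ∈ S, ∀ y, (G.colourClass a).Adj x y → y = w) : ¬ G.HasProperHamiltonianPath := by
  classical
  intro h
  obtain ⟨e, f, hf, hadj⟩ := h.exists_involutive_adj hodd a
  obtain ⟨x, hx, y, hy, hxy⟩ := one_lt_card.1 ((Nat.lt_sub_of_add_lt hS).trans_le
    (pred_card_le_card_erase (s := S) (a := e)))
  rw [mem_erase] at hx hy
  exact hxy (hf.injective
    ((hw x hx.2 _ (hadj x hx.1)).trans (hw y hy.2 _ (hadj y hy.1)).symm))

end NearPerfectMatching

section Sharpness

variable {n : ℕ}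

/-- The complete graph on the vertices `3, …, n - 1`, together with the edges joining the vertices
`0, 1, 2` to the vertex `3`. -/
def pendantGraph (n : ℕ) : SimpleGraph (Fin n) where
  Adj x y := x ≠ y ∧ (3 ≤ (x : ℕ) ∧ 3 ≤ (y : ℕ) ∨ (x : ℕ) = 3 ∨ (y : ℕ) = 3)
  symm := ⟨fun x y h => ⟨h.1.symm, by tauto⟩⟩
  loopless := ⟨fun x h => h.1 rfl⟩

/-- The extremal multigraph for odd `n`: colour `1` is complete, while colour `0` has three pendant
edges at a common vertex. -/
def sharpMultigraph (n : ℕ) : EdgeColouredMultigraph (Fin n) (Fin 2) where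
  colourClass := ![pendantGraph n, ⊤]

section

variable [DecidableRel (pendantGraph n)ᶜ.Adj]

theorem degree_compl_pendantGraph (hn : 4 ≤ n) (x : Fin n) :
    (pendantGraph n)ᶜ.degree x = if (x : ℕ) < 3 then n - 2 else if (x : ℕ) = 3 then 0 else 3 := by
  have hadj (y : Fin n) : (pendantGraph n)ᶜ.Adj x y ↔
      (x : ℕ) ≠ y ∧ ((x : ℕ) < 3 ∧ (y : ℕ) ≠ 3 ∨ (y : ℕ) < 3 ∧ (x : ℕ) ≠ 3) := by
    simp only [SimpleGraph.compl_adj, pendantGraph, ne_eq, Fin.ext_iff]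
    omega
  suffices h : (pendantGraph n)ᶜ.neighborFinset x =
      if (x : ℕ) < 3 then {x, ⟨3, hn⟩}ᶜ else if (x : ℕ) = 3 then ∅ else Iio ⟨3, hn⟩ by
    rw [← SimpleGraph.card_neighborFinset_eq_degree, h]
    split_ifs with hx
    · rw [card_compl, Fintype.card_fin, card_pair (Fin.ne_of_lt hx)]
    · exact card_empty
    · exact Fin.card_Iio _
  ext y
  rw [SimpleGraph.mem_neighborFinset, hadj]
  split_ifs <;> simp only [mem_compl, mem_insert, mem_singleton, notMem_empty, mem_Iio,
    Fin.ext_iff, Fin.lt_def, iff_false] <;> omega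

theorem two_mul_card_edgeFinset_compl_pendantGraph (hn : 4 ≤ n) :
    2 * #(pendantGraph n)ᶜ.edgeFinset = 6 * n - 18 := by
  rw [← SimpleGraph.sum_degrees_eq_twice_card_edges]
  simp only [degree_compl_pendantGraph hn]
  obtain ⟨k, rfl⟩ := Nat.exists_eq_add_of_le hn
  have htail (i : ℕ) : (if 4 + i < 3 then 4 + k - 2 else if 4 + i = 3 then 0 else 3) = 3 := by
    rw [if_neg (by omega), if_neg (by omega)]
  rw [Fin.sum_univ_eq_sum_range (fun i => if i < 3 then 4 + k - 2 else if i = 3 then 0 else 3),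
    sum_range_add, sum_congr rfl fun i _ => htail i, sum_const, card_range, smul_eq_mul]
  simp only [sum_range_succ, sum_range_zero, Nat.reduceLT, Nat.reduceEqDiff, if_true, if_false]
  omega

end

theorem numEdges_sharpMultigraph (hn : 4 ≤ n) :
    (sharpMultigraph n).numEdges = n.choose 2 + (n - 3).choose 2 + 3 := by
  classical
  have hadd := (sharpMultigraph n).numEdges_add_numMissing
  have h0 := two_mul_card_edgeFinset_compl_pendantGraph hn
  have hmiss0 : (sharpMultigraph n).numMissing 0 = #(pendantGraph n)ᶜ.edgeFinset :=
    (card_edgeFinset_compl_colourClass ..).symm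
  have hmiss1 : (sharpMultigraph n).numMissing 1 = 0 := by
    simp [numMissing, sharpMultigraph]
  have hchoose := choose_two_eq_choose_two_sub_three_add (n := n) (by omega)
  rw [Fintype.card_fin] at hadd
  omega

theorem rainbowDegree_sharpMultigraph (hn : 5 ≤ n) : (sharpMultigraph n).rainbowDegree = 2 := by
  have : Nonempty (Fin n) := ⟨⟨0, by omega⟩⟩
  have hpendant (x : Fin n) : ∃ y, (pendantGraph n).Adj x y := by
    by_cases hx : (x : ℕ) = 3
    · exact ⟨⟨4, by omega⟩, fun h => by simp [h] at hx, by simp [hx]⟩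
    · exact ⟨⟨3, by omega⟩, fun h => by simp [h] at hx, by simp⟩
  have hcolours (x : Fin n) :
      {i : Fin 2 | ∃ y, ((sharpMultigraph n).colourClass i).Adj x y} = Set.univ := by
    obtain ⟨y, hy⟩ := hpendant x
    refine Set.eq_univ_of_forall fun i => ⟨y, ?_⟩
    fin_cases i
    exacts [hy, hy.ne]
  have hvertex (x : Fin n) : (sharpMultigraph n).vertexRainbowDegree x = 2 := by
    rw [vertexRainbowDegree, hcolours, Set.ncard_univ, Nat.card_eq_fintype_card, Fintype.card_fin]
  rw [rainbowDegree, iInf_congr hvertex, ciInf_const]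

theorem not_hasProperHamiltonianPath_sharpMultigraph (hn : 4 ≤ n) (hodd : Odd n) :
    ¬ (sharpMultigraph n).HasProperHamiltonianPath := by
  refine not_hasProperHamiltonianPath_of_forall_adj_eq (a := 0)
    (S := univ.map (Fin.castLEEmb (show 3 ≤ n by omega))) (w := ⟨3, hn⟩)
    (by rwa [Fintype.card_fin]) (by simp) fun x hx y hxy => ?_
  obtain ⟨i, -, rfl⟩ := mem_map.1 hx
  obtain ⟨-, hxy⟩ : (pendantGraph n).Adj _ y := hxy
  rw [Fin.castLEEmb_apply, Fin.val_castLE] at hxy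
  exact Fin.ext (by simp only; omega)

end Sharpness

end EdgeColouredMultigraph

theorem theorem2 (n : ℕ) (hn : 14 ≤ n) :
    (∀ (V : Type*) [Fintype V] (G : EdgeColouredMultigraph V (Fin 2)),
      Fintype.card V = n →
      G.rainbowDegree = 2 →
      n.choose 2 + (n - 3).choose 2 + 4 ≤ G.numEdges →
      G.HasProperHamiltonianPath) ∧
    (Odd n → ∃ G : EdgeColouredMultigraph (Fin n) (Fin 2),
      G.rainbowDegree = 2 ∧
      G.numEdges = n.choose 2 + (n - 3).choose 2 + 3 ∧
      ¬ G.HasProperHamiltonianPath) := by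
  refine ⟨?_, fun hodd => ⟨EdgeColouredMultigraph.sharpMultigraph n,
    EdgeColouredMultigraph.rainbowDegree_sharpMultigraph (by omega),
    EdgeColouredMultigraph.numEdges_sharpMultigraph (by omega),
    EdgeColouredMultigraph.not_hasProperHamiltonianPath_sharpMultigraph (by omega) hodd⟩⟩
  rintro V _ G rfl hG hedges
  exact EdgeColouredMultigraph.hasProperHamiltonianPath_of_le_numEdges hn
    (EdgeColouredMultigraph.exists_colourClass_adj_of_rainbowDegree_eq_two hG) hedges
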